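/- Let $\mathcal G$ be an undirected network on the nodes $\{1,\dots,n\}$ and let $D\in\mathbb R^{n\times n}$ be its symmetric node-node matrix: $D_{ii}=1$, $D_{ij}=1$ if $i\ne j$ are joined by an edge, and $D_{ij}=0$ otherwise. Let $\Omega\subset\{1,\dots,n\}^2$ be a symmetric set of observed index pairs that contains all diagonal pairs $(i,i)$, and let $\pi_\Omega(A)$ denote the matrix that agrees with $A$ on $\Omega$ and is zero elsewhere. Let $\mathbb S_n$ be the space of symmetric real $n\times n$ matrices, $\langle A,B\rangle=\operatorname{Tr}(A^{\top}B)$, $\|\cdot\|_F$ the Frobenius norm (for a tuple of matrices, the square root of the sum of the squared Frobenius norms), $\|A\|_1=\sum_{i,j}|A_{ij}|$, $\|A\|_\infty=\max_{i,j}|A_{ij}|$, and $\|A\|_2$ the spectral norm. Put $$\phi=\{(X,S)\in\mathbb S_n\times\mathbb S_n:\ \pi_\Omega(X+S)=\pi_\Omega(D),\ X_{ij}\ge 0\ \forall i,j,\ S_{ii}=0\ \forall i,\ |S_{ij}|\le 1\ \forall i\ne j\}.$$ Let $\rho>0$ and consider the problem $$\min\{\operatorname{Tr}(L)+\rho\|S\|_1:\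 X=L,\ L\succeq 0,\ (X,S)\in\phi\}.\qquad(\mathrm P)$$ Let $(\mu_k)_{k\ge0}$ be a nondecreasing bounded sequence of positive reals. The algorithm ADMIPC starts from $L_0=0$ and $Y_0=\pi_\Omega(D)/\max\{\|\pi_\Omega(D)\|_2,\ \rho^{-1}\|\pi_\Omega(D)\|_\infty\}$ and iterates, for $k=0,1,2,\dots$, $$(X_{k+1},S_{k+1})\in\operatorname{argmin}\{\rho\|S\|_1+\tfrac{\mu_k}{2}\|X-L_k+Y_k/\mu_k\|_F^2:\ (X,S)\in\phi\},$$ $$L_{k+1}\in\operatorname{argmin}\{\operatorname{Tr}(L)+\tfrac{\mu_k}{2}\|L-X_{k+1}-Y_k/\mu_k\|_F^2:\ L\succeq0\},$$ $$Y_{k+1}=Y_k+\mu_k(X_{k+1}-L_{k+1}).$$ Let $Z_k=(L_k,X_k,S_k,Y_k)$ be its iterates (with $X_0,S_0$, which the algorithm does not use, arbitrary), and let $\mathcal Z^*$ be the set of optimal primal-dual pairs of $(\mathrm P)$, that is, the set of all $(L^*,X^*,S^*,Y^*)$ with $L^*\succeq0$, $(X^*,S^*)\in\phi$, $Y^*\in\mathbb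 S_n$, $X^*=L^*$, such that $$\langle I_n-Y^*,\,L-L^*\rangle\ge0\quad\forall L\succeq0,$$ and, for some $G\in\partial\|S^*\|_1$, $$\rho\langle G,S-S^*\rangle+\langle Y^*,X-X^*\rangle\ge0\quad\forall (X,S)\in\phi.$$ Then the minimum $\min\{\|Z_k-Z\|_F:\ Z\in\mathcal Z^*\}$ exists for every $k$ and tends to $0$ as $k\to\infty$. Moreover, the sequence $(Z_k)$ is bounded. -/

import Mathlib

open Filter Topology

/- The norm `‖A‖` of a matrix is the Frobenius norm. -/
attribute [local instance] Matrix.frobeniusNormedAddCommGroup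

namespace ADMIPC

noncomputable section

variable {n : ℕ}

/-- The node-node matrix `D` of an undirected network: ones on the diagonal, `D i j = 1` if `i`
and `j` are joined by an edge, and `D i j = 0` otherwise. -/
def netMatrix (G : SimpleGraph (Fin n)) : Matrix (Fin n) (Fin n) ℝ :=
  open Classical in fun i j => if i = j ∨ G.Adj i j then 1 else 0

/-- The projection `π_Ω`: keep the entries with index in `Ω`, put zeros elsewhere. -/
def proj (Ω : Set (Fin n × Fin n)) (A : Matrix (Fin n) (Fin n) ℝ) : Matrix (Fin n) (Fin n) ℝ :=
  open Classical in fun i j => if (i, j) ∈ Ω then A i j else 0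

/-- The trace inner product `⟨A, B⟩ = Tr (Aᵀ B)`. -/
def ip (A B : Matrix (Fin n) (Fin n) ℝ) : ℝ := (A.transpose * B).trace

/-- The entrywise norm `‖A‖₁ = ∑ |A i j|`. -/
def l1Norm (A : Matrix (Fin n) (Fin n) ℝ) : ℝ := ∑ i, ∑ j, |A i j|

/-- The spectral norm `‖A‖₂`. -/
def specNorm (A : Matrix (Fin n) (Fin n) ℝ) : ℝ := ‖Matrix.toEuclideanCLM (𝕜 := ℝ) A‖

/-- The entrywise norm `‖A‖_∞ = max |A i j|`. -/
def maxNorm (A : Matrix (Fin n) (Fin n) ℝ) : ℝ := ⨆ i, ⨆ j, |A i j|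

/-- The subdifferential of `‖·‖₁` at `S`, as a function on the space of symmetric matrices. -/
def subdiffL1 (S : Matrix (Fin n) (Fin n) ℝ) : Set (Matrix (Fin n) (Fin n) ℝ) :=
  {G | G.IsSymm ∧ ∀ T : Matrix (Fin n) (Fin n) ℝ, T.IsSymm →
    l1Norm S + ip G (T - S) ≤ l1Norm T}

/-- The set `φ` of pairs `(X, S)` of symmetric matrices with `π_Ω (X + S) = π_Ω (D)`, `X ≥ 0`
entrywise, `diag S = 0`, and `|S i j| ≤ 1` off the diagonal. -/
def phi (Ω : Set (Fin n × Fin n)) (D : Matrix (Fin n) (Fin n) ℝ) :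
    Set (Matrix (Fin n) (Fin n) ℝ × Matrix (Fin n) (Fin n) ℝ) :=
  {p | p.1.IsSymm ∧ p.2.IsSymm ∧ proj Ω (p.1 + p.2) = proj Ω D ∧
    (∀ i j, 0 ≤ p.1 i j) ∧ (∀ i, p.2 i i = 0) ∧ ∀ i j, i ≠ j → |p.2 i j| ≤ 1}

/-- A quadruple `Z = (L, X, S, Y)` of matrices. -/
structure Quad (n : ℕ) where
  L : Matrix (Fin n) (Fin n) ℝ
  X : Matrix (Fin n) (Fin n) ℝ
  S : Matrix (Fin n) (Fin n) ℝ
  Y : Matrix (Fin n) (Fin n) ℝ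

/-- The Frobenius norm `‖Z‖_F` of a quadruple. -/
def Quad.frob (Z : Quad n) : ℝ :=
  Real.sqrt (‖Z.L‖ ^ 2 + ‖Z.X‖ ^ 2 + ‖Z.S‖ ^ 2 + ‖Z.Y‖ ^ 2)

/-- The Frobenius distance `‖Z - W‖_F` of two quadruples. -/
def Quad.dist (Z W : Quad n) : ℝ :=
  Quad.frob ⟨Z.L - W.L, Z.X - W.X, Z.S - W.S, Z.Y - W.Y⟩

/-- `a` minimizes `f` over `s`. -/
def IsArgmin {α : Type*} (f : α → ℝ) (s : Set α) (a : α) : Prop := a ∈ s ∧ IsMinOn f s a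

/-- `Z 0, Z 1, …` are iterates of ADMIPC with parameter `ρ` and penalties `μ k`. The values
`(Z 0).X` and `(Z 0).S` are not used by the algorithm and are left free. -/
structure IsRun (Ω : Set (Fin n × Fin n)) (D : Matrix (Fin n) (Fin n) ℝ) (ρ : ℝ) (μ : ℕ → ℝ)
    (Z : ℕ → Quad n) : Prop where
  init_L : (Z 0).L = 0
  init_Y : (Z 0).Y =
    (max (specNorm (proj Ω D)) (ρ⁻¹ * maxNorm (proj Ω D)))⁻¹ • proj Ω D
  step_XS : ∀ k, IsArgmin
    (fun p : Matrix (Fin n) (Fin n) ℝ × Matrix (Fin n) (Fin n) ℝ =>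
      ρ * l1Norm p.2 + μ k / 2 * ‖p.1 - (Z k).L + (μ k)⁻¹ • (Z k).Y‖ ^ 2)
    (phi Ω D) ((Z (k + 1)).X, (Z (k + 1)).S)
  step_L : ∀ k, IsArgmin
    (fun L : Matrix (Fin n) (Fin n) ℝ =>
      L.trace + μ k / 2 * ‖L - (Z (k + 1)).X - (μ k)⁻¹ • (Z k).Y‖ ^ 2)
    {L | L.PosSemidef} (Z (k + 1)).L
  step_Y : ∀ k, (Z (k + 1)).Y = (Z k).Y + μ k • ((Z (k + 1)).X - (Z (k + 1)).L)

/-- The set of optimal primal-dual pairs of: minimize `Tr L + ρ ‖S‖₁` subject to `X = L`,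
`L ⪰ 0`, `(X, S) ∈ φ`. -/
def optPairs (Ω : Set (Fin n × Fin n)) (D : Matrix (Fin n) (Fin n) ℝ) (ρ : ℝ) : Set (Quad n) :=
  {W | W.L.PosSemidef ∧ (W.X, W.S) ∈ phi Ω D ∧ W.Y.IsSymm ∧
    (∀ L : Matrix (Fin n) (Fin n) ℝ, L.PosSemidef → 0 ≤ ip (1 - W.Y) (L - W.L)) ∧
    W.X = W.L ∧
    ∃ G ∈ subdiffL1 W.S, ∀ X S : Matrix (Fin n) (Fin n) ℝ, (X, S) ∈ phi Ω D →
      0 ≤ ρ * ip G (S - W.S) + ip W.Y (X - W.X)}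

end

end ADMIPC

-- ADMIPC is a two-block alternating direction method, and convergence rests on a Lyapunov function.
-- For an optimal pair `W` put `V k = ‖L_k - L*‖² + μ_k⁻² ‖Y_k - Y*‖²`. The first-order conditions
-- of the two subproblems, combined with those of `W` by monotonicity, show that `V` drops from step
-- `k` to step `k + 1` by at least `‖L_{k+1} - L_k‖² + ‖X_{k+1} - L_{k+1}‖²` for `k ≥ 1`
-- (`lyapunov_descent`). Monotonicity of `μ` lets the weight change from `μ_k` to `μ_{k+1}`. Hence
-- both residuals tend to zero. Boundedness of `μ` turns the bound on `V` into a bound on `Y_k` and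
-- gives `μ_k (L_{k+1} - L_k) → 0`, so every cluster point of the iterates satisfies the optimality
-- conditions (`IsRun.mem_optPairs_of_tendsto`). With the iterates in a compact set, the distance to
-- the optimal set tends to zero.
--
-- Two points need separate care. An optimal pair must exist: the primal feasible set is compact,
-- and a multiplier comes from Hahn-Banach separation with the Slater point `X = 1`
-- (`optPairs_nonempty`). Also, the conditions for `(X, S)` are used in the form of a minimality
-- inequality in `‖S‖₁`, which passes to limits; its equivalence with the single-subgradient form
-- (`mem_optPairs_iff`) uses that `φ` decouples into pairs of mirror entries.

attribute [local instance] Matrix.frobeniusNormedSpace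

namespace ADMIPC

/-- Real `n × n` matrices. -/
abbrev Mat (n : ℕ) := Matrix (Fin n) (Fin n) ℝ

/-! ### Trace inner product and Frobenius norm -/

section Linear

variable {n : ℕ}

theorem ip_eq_sum (A B : Mat n) : ip A B = ∑ i, ∑ j, A i j * B i j := by
  unfold ip
  rw [Finset.sum_comm]
  simp [Matrix.trace, Matrix.mul_apply]

theorem ip_comm (A B : Mat n) : ip A B = ip B A := by
  simp [ip_eq_sum, mul_comm]

theorem ip_add_left (A B C : Mat n) : ip (A + B) C = ip A C + ip B C := by
  simp [ip_eq_sum, add_mul, Finset.sum_add_distrib]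

theorem ip_sub_left (A B C : Mat n) : ip (A - B) C = ip A C - ip B C := by
  simp [ip_eq_sum, sub_mul, Finset.sum_sub_distrib]

theorem ip_smul_left (t : ℝ) (A C : Mat n) : ip (t • A) C = t * ip A C := by
  simp [ip_eq_sum, mul_assoc, Finset.mul_sum]

theorem ip_add_right (A B C : Mat n) : ip A (B + C) = ip A B + ip A C := by
  rw [ip_comm, ip_add_left, ip_comm B, ip_comm C]

theorem ip_sub_right (A B C : Mat n) : ip A (B - C) = ip A B - ip A C := by
  rw [ip_comm, ip_sub_left, ip_comm B, ip_comm C]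

theorem ip_smul_right (t : ℝ) (A C : Mat n) : ip A (t • C) = t * ip A C := by
  rw [ip_comm, ip_smul_left, ip_comm]

theorem norm_sq_eq_sum (A : Mat n) : ‖A‖ ^ 2 = ∑ i, ∑ j, A i j ^ 2 := by
  have h : 0 ≤ ∑ i, ∑ j, A i j ^ 2 :=
    Finset.sum_nonneg fun i _ => Finset.sum_nonneg fun j _ => sq_nonneg _
  have h2 : ‖A‖ = Real.sqrt (∑ i, ∑ j, A i j ^ 2) := by
    rw [Matrix.frobenius_norm_def, Real.sqrt_eq_rpow]
    simp
  rw [h2, Real.sq_sqrt h]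

theorem norm_sq_eq_ip (A : Mat n) : ‖A‖ ^ 2 = ip A A := by
  rw [norm_sq_eq_sum, ip_eq_sum]
  simp [sq]

theorem norm_le_of_abs_le_one {A : Mat n} (h : ∀ i j, |A i j| ≤ 1) : ‖A‖ ≤ n := by
  have h1 : ‖A‖ ^ 2 ≤ (n : ℝ) ^ 2 := by
    rw [norm_sq_eq_sum]
    calc ∑ i, ∑ j, A i j ^ 2 ≤ ∑ _i : Fin n, ∑ _j : Fin n, (1 : ℝ) :=
          Finset.sum_le_sum fun i _ => Finset.sum_le_sum fun j _ => by
            rw [sq_le_one_iff_abs_le_one]; exact h i j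
      _ = (n : ℝ) ^ 2 := by simp [sq]
  exact (le_abs_self _).trans (abs_le_of_sq_le_sq h1 (Nat.cast_nonneg n))

theorem l1Norm_combo_le {a b : ℝ} (ha : 0 ≤ a) (hb : 0 ≤ b) (A B : Mat n) :
    l1Norm (a • A + b • B) ≤ a * l1Norm A + b * l1Norm B := by
  simp only [l1Norm, Finset.mul_sum, ← Finset.sum_add_distrib]
  refine Finset.sum_le_sum fun i _ => Finset.sum_le_sum fun j _ => ?_
  simp only [Matrix.add_apply, Matrix.smul_apply, smul_eq_mul]
  refine (abs_add_le _ _).trans ?_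
  rw [abs_mul, abs_mul, abs_of_nonneg ha, abs_of_nonneg hb]

@[fun_prop]
theorem continuous_l1Norm : Continuous (l1Norm : Mat n → ℝ) := by
  unfold l1Norm
  fun_prop

@[fun_prop]
theorem continuous_ip {α : Type*} [TopologicalSpace α] {f g : α → Mat n}
    (hf : Continuous f) (hg : Continuous g) : Continuous fun x => ip (f x) (g x) := by
  simp only [ip_eq_sum]
  fun_prop

/-- Let `t → 0⁺`. This removes second-order terms from first-order conditions, and the perturbation
`ε` in the duality argument. -/
theorem nonneg_of_forall_add_mul {a b : ℝ} (h : ∀ t : ℝ, 0 < t → t ≤ 1 → 0 ≤ a + t * b) :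
    0 ≤ a := by
  have hc : Tendsto (fun t : ℝ => a + t * b) (𝓝[>] 0) (𝓝 a) := by
    have : Continuous fun t : ℝ => a + t * b := by fun_prop
    have h0 := this.tendsto 0
    simp only [zero_mul, add_zero] at h0
    exact h0.mono_left nhdsWithin_le_nhds
  refine ge_of_tendsto hc ?_
  filter_upwards [Ioc_mem_nhdsGT (zero_lt_one' ℝ)] with t ht
  exact h t ht.1 ht.2

end Linear

/-! ### The feasible set `φ`: convexity and closedness -/

section Feasible

variable {n : ℕ} {Ω : Set (Fin n × Fin n)} {D : Mat n}

theorem mem_phi_iff {X S : Mat n} : (X, S) ∈ phi Ω D ↔ X.IsSymm ∧ S.IsSymm ∧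
    (∀ i j, (i, j) ∈ Ω → X i j + S i j = D i j) ∧
    (∀ i j, 0 ≤ X i j) ∧ (∀ i, S i i = 0) ∧ ∀ i j, i ≠ j → |S i j| ≤ 1 := by
  have : proj Ω (X + S) = proj Ω D ↔ ∀ i j, (i, j) ∈ Ω → X i j + S i j = D i j := by
    rw [← Matrix.ext_iff]
    simp only [proj, Matrix.add_apply]
    refine forall_congr' fun i => forall_congr' fun j => ?_
    split_ifs with h <;> simp [h]
  simp only [phi, Set.mem_ofPred_eq, this]

theorem convex_phi : Convex ℝ (phi Ω D) := by
  rintro ⟨X, S⟩ h ⟨X', S'⟩ h' a b ha hb hab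
  rw [mem_phi_iff] at h h'
  obtain ⟨h1, h2, h3, h4, h5, h6⟩ := h
  obtain ⟨k1, k2, k3, k4, k5, k6⟩ := h'
  change (a • X + b • X', a • S + b • S') ∈ _
  rw [mem_phi_iff]
  refine ⟨(h1.smul a).add (k1.smul b), (h2.smul a).add (k2.smul b), ?_, ?_, ?_, ?_⟩
  · intro i j hij
    simp only [Matrix.add_apply, Matrix.smul_apply, smul_eq_mul]
    linear_combination a * h3 i j hij + b * k3 i j hij + D i j * hab
  · intro i j
    exact add_nonneg (mul_nonneg ha (h4 i j)) (mul_nonneg hb (k4 i j))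
  · intro i
    simp [h5 i, k5 i]
  · intro i j hij
    simp only [Matrix.add_apply, Matrix.smul_apply, smul_eq_mul]
    refine (abs_add_le _ _).trans ?_
    rw [abs_mul, abs_mul, abs_of_nonneg ha, abs_of_nonneg hb]
    nlinarith [h6 i j hij, k6 i j hij]

theorem isClosed_phi : IsClosed (phi Ω D) := by
  have : phi Ω D = {p : Mat n × Mat n | p.1.transpose = p.1} ∩
      {p | p.2.transpose = p.2} ∩
      (⋂ i, ⋂ j, ⋂ (_ : (i, j) ∈ Ω), {p | p.1 i j + p.2 i j = D i j}) ∩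
      (⋂ i, ⋂ j, {p | 0 ≤ p.1 i j}) ∩ (⋂ i, {p | p.2 i i = 0}) ∩
      (⋂ i, ⋂ j, ⋂ (_ : i ≠ j), {p | |p.2 i j| ≤ 1}) := by
    ext ⟨X, S⟩
    rw [mem_phi_iff]
    simp only [Set.mem_inter_iff, Set.mem_iInter, Set.mem_ofPred_eq, Matrix.IsSymm]
    tauto
  rw [this]
  refine ((((IsClosed.inter ?_ ?_).inter ?_).inter ?_).inter ?_).inter ?_
  · exact isClosed_eq (by fun_prop) (by fun_prop)
  · exact isClosed_eq (by fun_prop) (by fun_prop)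
  · refine isClosed_iInter fun i => isClosed_iInter fun j => isClosed_iInter fun _ =>
      isClosed_eq (by fun_prop) (by fun_prop)
  · exact isClosed_iInter fun i => isClosed_iInter fun j =>
      isClosed_le (by fun_prop) (by fun_prop)
  · exact isClosed_iInter fun i => isClosed_eq (by fun_prop) (by fun_prop)
  · exact isClosed_iInter fun i => isClosed_iInter fun j => isClosed_iInter fun _ =>
      isClosed_le (by fun_prop) (by fun_prop)

theorem abs_le_one_of_mem_phi {X S : Mat n} (h : (X, S) ∈ phi Ω D) (i j : Fin n) :
    |S i j| ≤ 1 := by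
  rw [mem_phi_iff] at h
  by_cases hij : i = j
  · subst hij
    simp [h.2.2.2.2.1 i]
  · exact h.2.2.2.2.2 i j hij

end Feasible

/-! ### Positive semidefinite matrices and interior points -/

section PosSemidef

variable {n : ℕ}

theorem posSemidef_iff_isSymm {A : Mat n} :
    A.PosSemidef ↔ A.IsSymm ∧ ∀ x : Fin n → ℝ, 0 ≤ x ⬝ᵥ A.mulVec x := by
  rw [Matrix.posSemidef_iff_dotProduct_mulVec]
  simp [Matrix.IsHermitian, Matrix.IsSymm, Matrix.conjTranspose_eq_transpose_of_trivial]

theorem isClosed_posSemidef : IsClosed {A : Mat n | A.PosSemidef} := by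
  have : {A : Mat n | A.PosSemidef} = {A | A.transpose = A} ∩
      ⋂ x : Fin n → ℝ, {A | 0 ≤ x ⬝ᵥ A.mulVec x} := by
    ext A
    simp [posSemidef_iff_isSymm, Matrix.IsSymm]
  rw [this]
  refine IsClosed.inter (isClosed_eq (by fun_prop) (by fun_prop)) (isClosed_iInter fun x => ?_)
  exact isClosed_le (by fun_prop) (by fun_prop)

/-- Matrices, not necessarily symmetric, with nonnegative quadratic form. -/
def quadNonneg (n : ℕ) : Set (Mat n) := {A | ∀ x : Fin n → ℝ, 0 ≤ x ⬝ᵥ A.mulVec x}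

theorem convex_quadNonneg : Convex ℝ (quadNonneg n) := by
  intro A hA B hB a b ha hb _ x
  rw [Matrix.add_mulVec, Matrix.smul_mulVec, Matrix.smul_mulVec, dotProduct_add,
    dotProduct_smul, dotProduct_smul]
  exact add_nonneg (mul_nonneg ha (hA x)) (mul_nonneg hb (hB x))

theorem dotProduct_mulVec_eq_ip (E : Mat n) (x : Fin n → ℝ) :
    x ⬝ᵥ E.mulVec x = ip E (Matrix.vecMulVec x x) := by
  simp only [ip_eq_sum, dotProduct, Matrix.mulVec, Matrix.vecMulVec_apply, Finset.mul_sum]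
  exact Finset.sum_congr rfl fun i _ => Finset.sum_congr rfl fun j _ => by ring

theorem abs_ip_le (A B : Mat n) : |ip A B| ≤ ‖A‖ * ‖B‖ := by
  refine abs_le_of_sq_le_sq ?_ (by positivity)
  rw [mul_pow, norm_sq_eq_sum, norm_sq_eq_sum, ip_eq_sum]
  simp only [← Finset.sum_product']
  exact Finset.sum_mul_sq_le_sq_mul_sq _ _ _

theorem norm_vecMulVec_self (x : Fin n → ℝ) : ‖Matrix.vecMulVec x x‖ = x ⬝ᵥ x := by
  have h0 : 0 ≤ x ⬝ᵥ x := Finset.sum_nonneg fun i _ => mul_self_nonneg _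
  rw [← sq_eq_sq₀ (norm_nonneg _) h0, norm_sq_eq_sum, sq, dotProduct, Finset.sum_mul_sum]
  exact Finset.sum_congr rfl fun i _ => Finset.sum_congr rfl fun j _ => by
    rw [Matrix.vecMulVec_apply]; ring

/-- By Cauchy-Schwarz and `‖x xᵀ‖ = x ⬝ᵥ x`, a perturbation of norm below `ε` changes the quadratic
form by at most `ε (x ⬝ᵥ x)`. Symmetry is dropped from the cone because symmetric matrices have
empty interior in the full matrix space once `n ≥ 2`. -/
theorem add_smul_one_mem_interior {A : Mat n} (hA : A ∈ quadNonneg n) {ε : ℝ} (hε : 0 < ε) :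
    A + ε • (1 : Mat n) ∈ interior (quadNonneg n) := by
  rw [mem_interior]
  refine ⟨Metric.ball (A + ε • (1 : Mat n)) ε, ?_, Metric.isOpen_ball, Metric.mem_ball_self hε⟩
  intro B hB x
  rw [Metric.mem_ball, dist_eq_norm] at hB
  have e : B = A + ε • (1 : Mat n) + (B - (A + ε • (1 : Mat n))) := by abel
  rw [e, Matrix.add_mulVec, Matrix.add_mulVec, dotProduct_add, dotProduct_add,
    Matrix.smul_mulVec, Matrix.one_mulVec, dotProduct_smul, smul_eq_mul,
    dotProduct_mulVec_eq_ip (B - _)]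
  have h1 := (abs_le.1 (abs_ip_le (B - (A + ε • (1 : Mat n))) (Matrix.vecMulVec x x))).1
  rw [norm_vecMulVec_self] at h1
  have h0 : 0 ≤ x ⬝ᵥ x := Finset.sum_nonneg fun i _ => mul_self_nonneg _
  have h2 := mul_le_mul_of_nonneg_right hB.le h0
  linarith [hA x]

/-- Test the quadratic form on `e_i + e_j` and `e_i - e_j`. -/
theorem posSemidef_abs_apply_le {A : Mat n} (hA : A.PosSemidef) (h1 : ∀ i, A i i = 1)
    (i j : Fin n) : |A i j| ≤ 1 := by
  obtain ⟨hs, hq⟩ := posSemidef_iff_isSymm.1 hA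
  have hji : A j i = A i j := hs.apply i j
  have hp := hq (Pi.single i 1 + Pi.single j 1)
  have hm := hq (Pi.single i 1 - Pi.single j 1)
  simp only [Matrix.mulVec_add, Matrix.mulVec_sub, add_dotProduct, sub_dotProduct,
    single_one_dotProduct, Pi.add_apply, Pi.sub_apply, Matrix.mulVec_single_one,
    Matrix.col_apply, h1, hji] at hp hm
  rw [abs_le]
  constructor <;> linarith

end PosSemidef

end ADMIPC

namespace ADMIPC

/-! ### From minimality in `‖S‖₁` to a single subgradient -/

section Subgradient

/-- A subgradient of the absolute value at `s`, chosen as close to `r` as possible. -/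
noncomputable def absSubgrad (r s : ℝ) : ℝ :=
  if 0 < s then 1 else if s < 0 then -1 else max (-1) (min 1 r)

theorem abs_absSubgrad_le (r s : ℝ) : |absSubgrad r s| ≤ 1 := by
  unfold absSubgrad
  split_ifs
  · simp
  · simp
  · rw [abs_le]
    exact ⟨le_max_left _ _, max_le (by norm_num) (min_le_left _ _)⟩

theorem absSubgrad_mul_self (r s : ℝ) : absSubgrad r s * s = |s| := by
  unfold absSubgrad
  split_ifs with h1 h2
  · rw [abs_of_pos h1, one_mul]
  · rw [abs_of_neg h2, neg_one_mul]
  · have : s = 0 := le_antisymm (not_lt.1 h1) (not_lt.1 h2)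
    simp [this]

theorem exists_step_le (s : ℝ) {c : ℝ} (hc : 0 < c) :
    ∃ t : ℝ, 0 < t ∧ t ≤ 1 ∧ |t * s| ≤ c := by
  refine ⟨min 1 (c / (|s| + 1)), lt_min one_pos (by positivity), min_le_left _ _, ?_⟩
  have h0 : 0 < min 1 (c / (|s| + 1)) := lt_min one_pos (by positivity)
  rw [abs_mul, abs_of_pos h0]
  calc min 1 (c / (|s| + 1)) * |s| ≤ c / (|s| + 1) * (|s| + 1) := by
        gcongr
        · exact min_le_right _ _
        · linarith
    _ = c := by field_simp

/-- If `s₀ ≠ 0`, a small `t` keeps the sign and `|·|` is linear there. If `s₀ = 0`, taking `t = 1`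
gives `y s ≤ ρ |s|`, so clipping `y / ρ` to `[-1, 1]` can only move it in the direction of the sign
of `s`. -/
theorem absSubgrad_variational {ρ y s₀ s : ℝ} (hρ : 0 < ρ)
    (h : ∀ t : ℝ, 0 < t → t ≤ 1 → 0 ≤ ρ * (|s₀ + t * (s - s₀)| - |s₀|) - y * (t * (s - s₀))) :
    0 ≤ ρ * absSubgrad (y / ρ) s₀ * (s - s₀) - y * (s - s₀) := by
  unfold absSubgrad
  split_ifs with h1 h2
  · obtain ⟨t, t0, t1, ht⟩ := exists_step_le (s - s₀) h1
    have := h t t0 t1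
    rw [abs_of_nonneg (by linarith [(abs_le.1 ht).1]), abs_of_pos h1] at this
    exact nonneg_of_mul_nonneg_right (by linarith) t0
  · obtain ⟨t, t0, t1, ht⟩ := exists_step_le (s - s₀) (neg_pos.2 h2)
    have := h t t0 t1
    rw [abs_of_nonpos (by linarith [(abs_le.1 ht).2]), abs_of_neg h2] at this
    exact nonneg_of_mul_nonneg_right (by linarith) t0
  · have hs : s₀ = 0 := le_antisymm (not_lt.1 h1) (not_lt.1 h2)
    subst hs
    have := h 1 one_pos le_rfl
    simp only [zero_add, one_mul, sub_zero, abs_zero] at this ⊢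
    have hy : y = ρ * (y / ρ) := by field_simp
    rw [hy] at this
    generalize y / ρ = r at *
    subst hy
    rw [← sub_mul, ← mul_sub]
    rcases lt_trichotomy s 0 with h | h | h
    · rw [abs_of_neg h] at this
      have hr : -1 ≤ r := by
        by_contra! hr
        nlinarith [mul_pos hρ (neg_pos.2 h)]
      refine mul_nonneg_of_nonpos_of_nonpos (mul_nonpos_of_nonneg_of_nonpos hρ.le ?_) h.le
      exact sub_nonpos.2 (max_le hr (min_le_right _ _))
    · simp [h]
    · rw [abs_of_pos h] at this
      have hr : r ≤ 1 := by
        by_contra! hr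
        nlinarith [mul_pos hρ h]
      refine mul_nonneg (mul_nonneg hρ.le ?_) h.le
      exact sub_nonneg.2 (le_max_of_le_right (le_min hr le_rfl))

variable {n : ℕ} {Ω : Set (Fin n × Fin n)} {D : Mat n} {ρ : ℝ}

theorem mem_subdiffL1_of_entrywise {G S : Mat n} (hG : G.IsSymm) (h1 : ∀ i j, |G i j| ≤ 1)
    (h2 : ∀ i j, G i j * S i j = |S i j|) : G ∈ subdiffL1 S := by
  refine ⟨hG, fun T _ => ?_⟩
  have h3 : ip G S = l1Norm S := by
    simp only [ip_eq_sum, l1Norm, h2]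
  have h4 : ip G T ≤ l1Norm T := by
    simp only [ip_eq_sum, l1Norm]
    refine Finset.sum_le_sum fun i _ => Finset.sum_le_sum fun j _ => ?_
    calc G i j * T i j ≤ |G i j * T i j| := le_abs_self _
      _ = |G i j| * |T i j| := abs_mul _ _
      _ ≤ 1 * |T i j| := by gcongr; exact h1 i j
      _ = |T i j| := one_mul _
  rw [ip_sub_right]
  linarith

open Classical in
/-- Replace the entries `(i, j)` and `(j, i)` of `A` by those of `B`. -/
noncomputable def patch (i j : Fin n) (A B : Mat n) : Mat n :=
  fun a b => if (a, b) ∈ ({(i, j), (j, i)} : Finset (Fin n × Fin n)) then B a b else A a b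

theorem patch_isSymm (i j : Fin n) {A B : Mat n} (hA : A.IsSymm) (hB : B.IsSymm) :
    (patch i j A B).IsSymm := by
  refine Matrix.IsSymm.ext fun a b => ?_
  have : (b, a) ∈ ({(i, j), (j, i)} : Finset (Fin n × Fin n)) ↔
      (a, b) ∈ ({(i, j), (j, i)} : Finset (Fin n × Fin n)) := by
    simp only [Finset.mem_insert, Finset.mem_singleton, Prod.mk.injEq]
    tauto
  simp only [patch, this, hA.apply, hB.apply]

/-- Symmetry is the only constraint of `φ` that couples different positions, so a pair of mirror
entries can be exchanged freely. -/
theorem patch_mem_phi (i j : Fin n) {X S X' S' : Mat n} (h : (X, S) ∈ phi Ω D)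
    (h' : (X', S') ∈ phi Ω D) : (patch i j X X', patch i j S S') ∈ phi Ω D := by
  rw [mem_phi_iff] at *
  obtain ⟨h1, h2, h3, h4, h5, h6⟩ := h
  obtain ⟨k1, k2, k3, k4, k5, k6⟩ := h'
  refine ⟨patch_isSymm i j h1 k1, patch_isSymm i j h2 k2, ?_, ?_, ?_, ?_⟩
  all_goals intros; unfold patch; split_ifs <;> simp_all

/-- Testing minimality on a patched pair leaves only the entries `(i, j)` and `(j, i)`, whose
contributions agree by symmetry. -/
theorem entrywise_of_minimal {X S Y : Mat n} (hY : Y.IsSymm) (hXS : (X, S) ∈ phi Ω D)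
    (h : ∀ X' S' : Mat n, (X', S') ∈ phi Ω D →
      0 ≤ ρ * (l1Norm S' - l1Norm S) + ip Y (X' - X))
    {X' S' : Mat n} (h' : (X', S') ∈ phi Ω D) (i j : Fin n) :
    0 ≤ ρ * (|S' i j| - |S i j|) + Y i j * (X' i j - X i j) := by
  classical
  have key := h _ _ (patch_mem_phi i j hXS h')
  have e : ρ * (l1Norm (patch i j S S') - l1Norm S) + ip Y (patch i j X X' - X) =
      ∑ p ∈ ({(i, j), (j, i)} : Finset (Fin n × Fin n)),
        (ρ * (|S' p.1 p.2| - |S p.1 p.2|) + Y p.1 p.2 * (X' p.1 p.2 - X p.1 p.2)) := by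
    have ite := Finset.sum_ite_mem Finset.univ ({(i, j), (j, i)} : Finset (Fin n × Fin n))
      fun p => ρ * (|S' p.1 p.2| - |S p.1 p.2|) + Y p.1 p.2 * (X' p.1 p.2 - X p.1 p.2)
    rw [Finset.univ_inter] at ite
    rw [← ite, Fintype.sum_prod_type]
    simp only [l1Norm, ip_eq_sum, ← Finset.sum_sub_distrib, Finset.mul_sum,
      ← Finset.sum_add_distrib]
    refine Finset.sum_congr rfl fun a _ => Finset.sum_congr rfl fun b _ => ?_
    simp only [Matrix.sub_apply, patch]
    split_ifs <;> ring
  rw [e] at key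
  rw [mem_phi_iff] at hXS h'
  by_cases hij : i = j
  · subst hij
    simpa using key
  · rw [Finset.sum_pair (by simp [hij])] at key
    simp only [hXS.1.apply i j, hXS.2.1.apply i j, h'.1.apply i j, h'.2.1.apply i j,
      hY.apply i j] at key
    linarith

theorem proj_mem_phi {X S : Mat n} (hΩ : ∀ i j, (i, j) ∈ Ω → (j, i) ∈ Ω)
    (h : (X, S) ∈ phi Ω D) : (X, proj Ω S) ∈ phi Ω D := by
  classical
  rw [mem_phi_iff] at *
  obtain ⟨h1, h2, h3, h4, h5, h6⟩ := h
  refine ⟨h1, Matrix.IsSymm.ext fun i j => ?_, ?_, h4, ?_, ?_⟩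
  · have : (j, i) ∈ Ω ↔ (i, j) ∈ Ω := ⟨hΩ j i, hΩ i j⟩
    exact if_congr this (h2.apply i j) rfl
  all_goals intros; unfold proj; split_ifs <;> simp_all

/-- The subgradient is built entrywise. On `Ω` the relation `X = D - S` leaves a scalar problem in
`S i j`. Off `Ω` the entries of `X` and `S` are independent, so minimality forces `S i j = 0` and
the subgradient entry `0` works. -/
theorem exists_subgradient_of_minimal (hΩ : ∀ i j, (i, j) ∈ Ω → (j, i) ∈ Ω) (hρ : 0 < ρ)
    {X S Y : Mat n} (hY : Y.IsSymm) (hXS : (X, S) ∈ phi Ω D)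
    (h : ∀ X' S' : Mat n, (X', S') ∈ phi Ω D →
      0 ≤ ρ * (l1Norm S' - l1Norm S) + ip Y (X' - X)) :
    ∃ G ∈ subdiffL1 S, ∀ X' S' : Mat n, (X', S') ∈ phi Ω D →
      0 ≤ ρ * ip G (S' - S) + ip Y (X' - X) := by
  classical
  have ent := fun {X' S' : Mat n} (h' : (X', S') ∈ phi Ω D) =>
    entrywise_of_minimal hY hXS h h'
  have hoff : ∀ i j, (i, j) ∉ Ω → S i j = 0 := by
    intro i j hij
    have := ent (proj_mem_phi hΩ hXS) i j
    simp only [proj, hij, if_false, abs_zero, sub_self, mul_zero, add_zero, zero_sub,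
      mul_neg, Left.nonneg_neg_iff] at this
    exact abs_nonpos_iff.1 (nonpos_of_mul_nonpos_right this hρ)
  have hSs := (mem_phi_iff.1 hXS).2.1
  refine ⟨Matrix.of fun i j => if (i, j) ∈ Ω then absSubgrad (Y i j / ρ) (S i j) else 0,
    mem_subdiffL1_of_entrywise (Matrix.IsSymm.ext fun i j => ?_) (fun i j => ?_)
      fun i j => ?_, fun X' S' h' => ?_⟩
  · have : (j, i) ∈ Ω ↔ (i, j) ∈ Ω := ⟨hΩ j i, hΩ i j⟩
    simp only [Matrix.of_apply, this, hY.apply, hSs.apply]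
  · rw [Matrix.of_apply]
    split_ifs
    · exact abs_absSubgrad_le _ _
    · simp
  · rw [Matrix.of_apply]
    split_ifs with hij
    · exact absSubgrad_mul_self _ _
    · simp [hoff i j hij]
  · simp only [ip_eq_sum, Finset.mul_sum, ← Finset.sum_add_distrib]
    refine Finset.sum_nonneg fun i _ => Finset.sum_nonneg fun j _ => ?_
    simp only [Matrix.sub_apply, Matrix.of_apply]
    split_ifs with hij
    · have eX : X i j = D i j - S i j := by
        linarith [(mem_phi_iff.1 hXS).2.2.1 i j hij]
      have eX' : X' i j = D i j - S' i j := by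
        linarith [(mem_phi_iff.1 h').2.2.1 i j hij]
      have := absSubgrad_variational (y := Y i j) (s₀ := S i j) (s := S' i j) hρ
        fun t t0 t1 => by
          have hc : ((1 - t) • X + t • X', (1 - t) • S + t • S') ∈ phi Ω D :=
            convex_phi hXS h' (sub_nonneg.2 t1) t0.le (by ring)
          have := ent hc i j
          simp only [Matrix.add_apply, Matrix.smul_apply, smul_eq_mul, eX, eX'] at this
          rw [show (1 - t) * S i j + t * S' i j = S i j + t * (S' i j - S i j) by ring] at this
          linarith
      rw [eX, eX']
      linarith
    · have := ent (proj_mem_phi hΩ h') i j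
      simpa [proj, hij, hoff i j hij] using this

theorem mem_optPairs_iff (hΩ : ∀ i j, (i, j) ∈ Ω → (j, i) ∈ Ω) (hρ : 0 < ρ) {W : Quad n} :
    W ∈ optPairs Ω D ρ ↔ W.L.PosSemidef ∧ (W.X, W.S) ∈ phi Ω D ∧ W.Y.IsSymm ∧
      (∀ L : Mat n, L.PosSemidef → 0 ≤ ip (1 - W.Y) (L - W.L)) ∧ W.X = W.L ∧
      ∀ X S : Mat n, (X, S) ∈ phi Ω D →
        0 ≤ ρ * (l1Norm S - l1Norm W.S) + ip W.Y (X - W.X) := by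
  constructor
  · rintro ⟨h1, h2, h3, h4, h5, G, ⟨_, hG⟩, h6⟩
    refine ⟨h1, h2, h3, h4, h5, fun X S h => ?_⟩
    have k1 := h6 X S h
    have k2 := hG S (mem_phi_iff.1 h).2.1
    nlinarith
  · rintro ⟨h1, h2, h3, h4, h5, h6⟩
    exact ⟨h1, h2, h3, h4, h5, exists_subgradient_of_minimal hΩ hρ h3 h2 h6⟩

end Subgradient

/-! ### Existence of an optimal primal-dual pair -/

section Duality

variable {n : ℕ} {Ω : Set (Fin n × Fin n)} {D : Mat n} {ρ : ℝ}

theorem one_mem_phi (hs : D.IsSymm) (h1 : ∀ i, D i i = 1) (hD : ∀ i j, |D i j| ≤ 1) :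
    ((1 : Mat n), D - 1) ∈ phi Ω D := by
  rw [mem_phi_iff]
  refine ⟨Matrix.isSymm_one, hs.sub Matrix.isSymm_one, by simp, ?_, by simp [h1], ?_⟩
  · intro i j
    rw [Matrix.one_apply]
    split_ifs <;> norm_num
  · intro i j hij
    simpa [Matrix.one_apply_ne hij] using hD i j

/-- The problem `min {Tr L + ρ ‖S‖₁ : X = L, L ⪰ 0, (X, S) ∈ φ}` has a solution. -/
theorem exists_primal_optimal (hΩdiag : ∀ i, (i, i) ∈ Ω) (hs : D.IsSymm)
    (h1 : ∀ i, D i i = 1) (hD : ∀ i j, |D i j| ≤ 1) :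
    ∃ X S : Mat n, (X, S) ∈ phi Ω D ∧ X.PosSemidef ∧
      ∀ X' S' : Mat n, (X', S') ∈ phi Ω D → X'.PosSemidef →
        X.trace + ρ * l1Norm S ≤ X'.trace + ρ * l1Norm S' := by
  let F : Set (Mat n × Mat n) := phi Ω D ∩ {p | p.1.PosSemidef}
  have hF : IsCompact F := by
    refine Metric.isCompact_of_isClosed_isBounded
      (isClosed_phi.inter (isClosed_posSemidef.preimage continuous_fst)) ?_
    refine (isBounded_iff_forall_norm_le).2 ⟨n, ?_⟩
    rintro ⟨X, S⟩ ⟨hp, hX⟩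
    -- The diagonal lies in `Ω` and `S` vanishes there, so `X` has unit diagonal; this bounds all
    -- its entries.
    have hp' := mem_phi_iff.1 hp
    refine max_le (norm_le_of_abs_le_one (posSemidef_abs_apply_le hX fun i => ?_))
      (norm_le_of_abs_le_one (abs_le_one_of_mem_phi hp))
    have := hp'.2.2.1 i i (hΩdiag i)
    rwa [hp'.2.2.2.2.1 i, add_zero, h1 i] at this
  obtain ⟨⟨X, S⟩, hXS, hmin⟩ := hF.exists_isMinOn (f := fun p : Mat n × Mat n =>
    p.1.trace + ρ * l1Norm p.2) ⟨(1, D - 1), one_mem_phi hs h1 hD, Matrix.PosSemidef.one⟩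
    (by fun_prop)
  exact ⟨X, S, hXS.1, hXS.2, fun X' S' h h' => hmin (show (X', S') ∈ F from ⟨h, h'⟩)⟩

theorem exists_ip_representation (f : (Mat n × ℝ) →L[ℝ] ℝ) :
    ∃ (Y : Mat n) (c : ℝ), ∀ M t, f (M, t) = ip Y M + c * t := by
  refine ⟨Matrix.of fun i j => f (Matrix.single i j 1, 0), f (0, 1), fun M t => ?_⟩
  have e : (M, t) = (M, (0 : ℝ)) + t • ((0 : Mat n), (1 : ℝ)) := by ext <;> simp
  have e2 : f (M, 0) = ∑ i, ∑ j, f (Matrix.single i j 1, 0) * M i j := by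
    have hM : (M, (0 : ℝ)) = ∑ i, ∑ j, M i j • (Matrix.single i j (1 : ℝ), (0 : ℝ)) := by
      refine Prod.ext ?_ ?_
      · conv_lhs => rw [Matrix.matrix_eq_sum_single M]
        simp [Prod.fst_sum]
      · simp [Prod.snd_sum]
    rw [hM, map_sum]
    simp only [map_sum, map_smul, smul_eq_mul, mul_comm]
  rw [e, map_add, map_smul, e2, ip_eq_sum, smul_eq_mul, mul_comm t]
  rfl

/-- Strong Lagrangian duality for the constraint `X = L`, by separation at the Slater point
`X = 1`. -/
theorem exists_multiplier (hs : D.IsSymm) (h1 : ∀ i, D i i = 1) (hD : ∀ i j, |D i j| ≤ 1)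
    (hρ : 0 < ρ) {v : ℝ} (hv : ∀ X S : Mat n, (X, S) ∈ phi Ω D → X.PosSemidef →
      v ≤ X.trace + ρ * l1Norm S) :
    ∃ Y : Mat n, Y.IsSymm ∧ ∀ L X S : Mat n, L.PosSemidef → (X, S) ∈ phi Ω D →
      v ≤ L.trace + ρ * l1Norm S + ip Y (X - L) := by
  -- Perturbations `M` of the constraint `X - L = 0`, with `L = X - M`, paired with strict upper
  -- bounds `t` on the excess of the objective over `v`. The origin is excluded because `v` is a
  -- lower bound.
  let A : Set (Mat n × ℝ) := {q | ∃ p ∈ phi Ω D, p.1 - q.1 ∈ interior (quadNonneg n) ∧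
    (p.1 - q.1).trace + ρ * l1Norm p.2 - v < q.2}
  have hconv : Convex ℝ A := by
    rintro ⟨M, t⟩ ⟨⟨X, S⟩, hp, hi, ht⟩ ⟨M', t'⟩ ⟨⟨X', S'⟩, hp', hi', ht'⟩ a b ha hb hab
    refine ⟨_, convex_phi hp hp' ha hb hab, ?_, ?_⟩
    · have := convex_quadNonneg.interior hi hi' ha hb hab
      convert this using 1
      simp only [Prod.fst_add, Prod.smul_fst, smul_sub]
      abel
    · simp only [Prod.fst_add, Prod.smul_fst, Prod.snd_add, Prod.smul_snd, smul_eq_mul] at *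
      have hl := mul_le_mul_of_nonneg_left (l1Norm_combo_le ha hb S S') hρ.le
      have e : (a • X + b • X' - (a • M + b • M')).trace =
          a * (X - M).trace + b * (X' - M').trace := by
        simp only [Matrix.trace_sub, Matrix.trace_add, Matrix.trace_smul, smul_eq_mul]
        ring
      rw [e]
      have hb' : b = 1 - a := by linarith
      subst hb'
      rcases ha.eq_or_lt with rfl | ha'
      · nlinarith
      · nlinarith [mul_lt_mul_of_pos_left ht ha', mul_le_mul_of_nonneg_left ht'.le hb]
  have hopen : IsOpen A := by
    have : A = ⋃ p ∈ phi Ω D, {q : Mat n × ℝ | p.1 - q.1 ∈ interior (quadNonneg n) ∧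
        (p.1 - q.1).trace + ρ * l1Norm p.2 - v < q.2} := by
      ext q
      simp only [A, Set.mem_iUnion, Set.mem_ofPred_eq, exists_prop]
    rw [this]
    refine isOpen_biUnion fun p _ => IsOpen.inter
      (s := {q : Mat n × ℝ | p.1 - q.1 ∈ interior (quadNonneg n)})
      (t := {q : Mat n × ℝ | (p.1 - q.1).trace + ρ * l1Norm p.2 - v < q.2}) ?_ ?_
    · exact isOpen_interior.preimage (f := fun q : Mat n × ℝ => p.1 - q.1) (by fun_prop)
    · exact isOpen_lt (by fun_prop) (by fun_prop)
  have h0 : (0 : Mat n × ℝ) ∉ A := by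
    rintro ⟨⟨X, S⟩, hp, hi, ht⟩
    simp only [Prod.fst_zero, Prod.snd_zero, sub_zero] at hi ht
    have := hv X S hp (posSemidef_iff_isSymm.2 ⟨(mem_phi_iff.1 hp).1, interior_subset hi⟩)
    linarith
  obtain ⟨f, hf⟩ := geometric_hahn_banach_point_open hconv hopen h0
  obtain ⟨Y, c, hYc⟩ := exists_ip_representation f
  have hpos : ∀ (L X S : Mat n) (ε : ℝ), L.PosSemidef → (X, S) ∈ phi Ω D → 0 < ε →
      0 < ip Y (X - (L + ε • (1 : Mat n))) +
        c * ((L + ε • (1 : Mat n)).trace + ρ * l1Norm S - v + ε) := by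
    intro L X S ε hL hp hε
    have := hf (X - (L + ε • (1 : Mat n)), (L + ε • (1 : Mat n)).trace + ρ * l1Norm S - v + ε)
      ⟨(X, S), hp, by
        simpa using add_smul_one_mem_interior (posSemidef_iff_isSymm.1 hL).2 hε, by simp [hε]⟩
    rwa [map_zero, hYc] at this
  -- The separating functional is not vertical: the Slater point `X = 1`, with `M = 0` and `t`
  -- large, lies in `A`, where the functional reduces to `c * t`.
  have hc : 0 < c := by
    have hp := one_mem_phi (Ω := Ω) hs h1 hD
    have hm := hf (0, |(1 : Mat n).trace + ρ * l1Norm (D - 1) - v| + 1) ⟨_, hp, by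
      simpa using add_smul_one_mem_interior (A := (0 : Mat n)) (fun x => by simp) one_pos, by
      simp only [sub_zero]
      linarith [le_abs_self ((1 : Mat n).trace + ρ * l1Norm (D - 1) - v)]⟩
    rw [map_zero, hYc, ip_eq_sum] at hm
    simp only [Matrix.zero_apply, mul_zero, Finset.sum_const_zero, zero_add] at hm
    exact pos_of_mul_pos_left hm (by positivity)
  have hlim : ∀ L X S : Mat n, L.PosSemidef → (X, S) ∈ phi Ω D →
      0 ≤ ip Y (X - L) + c * (L.trace + ρ * l1Norm S - v) := by
    intro L X S hL hp
    refine nonneg_of_forall_add_mul (b := -ip Y 1 + c * ((1 : Mat n).trace + 1))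
      fun ε hε _ => ?_
    have := hpos L X S ε hL hp hε
    simp only [ip_sub_right, ip_add_right, ip_smul_right, Matrix.trace_add,
      Matrix.trace_smul, smul_eq_mul] at this ⊢
    linarith
  -- Divide by `c` and symmetrize; since `X - L` is symmetric, `Y` and its transpose pair with it
  -- equally.
  refine ⟨(2 * c)⁻¹ • (Y + Y.transpose), ?_, fun L X S hL hp => ?_⟩
  · exact (Matrix.isSymm_add_transpose_self Y).smul _
  · have hsym : (X - L).IsSymm := (mem_phi_iff.1 hp).1.sub (posSemidef_iff_isSymm.1 hL).1
    have ht : ip Y.transpose (X - L) = ip Y (X - L) := by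
      rw [ip_eq_sum, ip_eq_sum, Finset.sum_comm]
      simp only [Matrix.transpose_apply, hsym.apply]
    have hl := hlim L X S hL hp
    rw [ip_smul_left, ip_add_left, ht]
    have e : (2 * c)⁻¹ * (ip Y (X - L) + ip Y (X - L)) = ip Y (X - L) / c := by
      field_simp
      ring
    rw [e]
    have : 0 ≤ (ip Y (X - L) + c * (L.trace + ρ * l1Norm S - v)) / c := div_nonneg hl hc.le
    rw [add_div, mul_div_cancel_left₀ _ hc.ne'] at this
    linarith

theorem trace_eq_ip (L : Mat n) : L.trace = ip 1 L := by
  simp [ip]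

/-- A primal solution and its multiplier form a saddle point of the Lagrangian; freezing one block
at the solution gives the condition for the other. -/
theorem optPairs_nonempty (hΩdiag : ∀ i, (i, i) ∈ Ω) (hΩ : ∀ i j, (i, j) ∈ Ω → (j, i) ∈ Ω)
    (hρ : 0 < ρ) (hs : D.IsSymm) (h1 : ∀ i, D i i = 1) (hD : ∀ i j, |D i j| ≤ 1) :
    (optPairs Ω D ρ).Nonempty := by
  obtain ⟨X, S, hp, hX, hmin⟩ := exists_primal_optimal (ρ := ρ) hΩdiag hs h1 hD
  obtain ⟨Y, hY, hdual⟩ := exists_multiplier hs h1 hD hρ hmin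
  refine ⟨⟨X, X, S, Y⟩, (mem_optPairs_iff hΩ hρ).2 ⟨hX, hp, hY, fun L hL => ?_, rfl,
    fun X' S' h' => ?_⟩⟩
  · have := hdual L X S hL hp
    simp only [trace_eq_ip, ip_sub_left, ip_sub_right] at this ⊢
    linarith
  · have := hdual X X' S' hX h'
    simp only at this ⊢
    linarith

end Duality

end ADMIPC

namespace ADMIPC

/-! ### First-order conditions of the subproblems and the descent estimate -/

section Optimality

variable {n : ℕ} {Ω : Set (Fin n × Fin n)} {D : Mat n} {ρ : ℝ}

theorem norm_add_smul_sq (A B : Mat n) (t : ℝ) :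
    ‖A + t • B‖ ^ 2 = ‖A‖ ^ 2 + 2 * t * ip A B + t ^ 2 * ‖B‖ ^ 2 := by
  simp only [norm_sq_eq_ip, ip_add_left, ip_add_right, ip_smul_left, ip_smul_right, ip_comm B A]
  ring

/-- Minimality is compared along the segment towards `(X, S)`: convexity handles the `ℓ₁` term, the
square expands exactly, and after division by `t` its remainder vanishes as `t → 0`. -/
theorem argmin_XS_variational {m : ℝ} (hm : 0 < m) (hρ : 0 < ρ) {L Y X₁ S₁ : Mat n}
    (h : IsArgmin (fun p : Mat n × Mat n => ρ * l1Norm p.2 + m / 2 * ‖p.1 - L + m⁻¹ • Y‖ ^ 2)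
      (phi Ω D) (X₁, S₁)) {X S : Mat n} (hXS : (X, S) ∈ phi Ω D) :
    0 ≤ ρ * (l1Norm S - l1Norm S₁) + ip (Y + m • (X₁ - L)) (X - X₁) := by
  refine nonneg_of_forall_add_mul (b := m / 2 * ‖X - X₁‖ ^ 2) fun t t0 t1 => ?_
  have hc : ((1 - t) • X₁ + t • X, (1 - t) • S₁ + t • S) ∈ phi Ω D :=
    convex_phi h.1 hXS (sub_nonneg.2 t1) t0.le (by ring)
  have hmin := isMinOn_iff.1 h.2 _ hc
  have e : (1 - t) • X₁ + t • X - L + m⁻¹ • Y = (X₁ - L + m⁻¹ • Y) + t • (X - X₁) := by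
    module
  have e2 : Y + m • (X₁ - L) = m • (X₁ - L + m⁻¹ • Y) := by
    rw [smul_add, smul_inv_smul₀ hm.ne', add_comm]
  have hl := mul_le_mul_of_nonneg_left
    (l1Norm_combo_le (sub_nonneg.2 t1) t0.le S₁ S) hρ.le
  simp only [e, norm_add_smul_sq] at hmin
  rw [e2, ip_smul_left]
  refine nonneg_of_mul_nonneg_right (a := t) ?_ t0
  nlinarith

theorem argmin_L_variational {m : ℝ} (hm : 0 < m) {X Y L₁ : Mat n}
    (h : IsArgmin (fun L : Mat n => L.trace + m / 2 * ‖L - X - m⁻¹ • Y‖ ^ 2)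
      {L | L.PosSemidef} L₁) {L : Mat n} (hL : L.PosSemidef) :
    0 ≤ ip (1 - (Y + m • (X - L₁))) (L - L₁) := by
  refine nonneg_of_forall_add_mul (b := m / 2 * ‖L - L₁‖ ^ 2) fun t t0 t1 => ?_
  have hc : ((1 - t) • L₁ + t • L).PosSemidef :=
    (h.1.smul (sub_nonneg.2 t1)).add (hL.smul t0.le)
  have hmin := isMinOn_iff.1 h.2 _ hc
  have e : (1 - t) • L₁ + t • L - X - m⁻¹ • Y = (L₁ - X - m⁻¹ • Y) + t • (L - L₁) := by
    module
  have e2 : Y + m • (X - L₁) = (-m) • (L₁ - X - m⁻¹ • Y) := by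
    have : m • m⁻¹ • Y = Y := smul_inv_smul₀ hm.ne' Y
    nth_rewrite 1 [← this]
    module
  simp only [e, norm_add_smul_sq, Matrix.trace_add, Matrix.trace_smul, smul_eq_mul] at hmin
  rw [e2, ip_sub_left, ip_smul_left, ← trace_eq_ip, Matrix.trace_sub]
  refine nonneg_of_mul_nonneg_right (a := t) ?_ t0
  nlinarith

/-- The basic contraction estimate of the alternating direction method. -/
theorem lyapunov_descent {m s s₁ : ℝ} (hm : 0 < m) {L Y L₁ X₁ Y₁ L' Y' : Mat n}
    (hY : Y₁ = Y + m • (X₁ - L₁))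
    (hXS : 0 ≤ ρ * (s - s₁) + ip (Y₁ + m • (L₁ - L)) (L' - X₁))
    (hXS' : 0 ≤ ρ * (s₁ - s) + ip Y' (X₁ - L'))
    (hL₁ : 0 ≤ ip (1 - Y₁) (L' - L₁)) (hL' : 0 ≤ ip (1 - Y') (L₁ - L'))
    (hL₁' : 0 ≤ ip (1 - Y₁) (L - L₁)) (hL : 0 ≤ ip (1 - Y) (L₁ - L)) :
    ‖L₁ - L'‖ ^ 2 + (m⁻¹ * ‖Y₁ - Y'‖) ^ 2 + ‖L₁ - L‖ ^ 2 + (m⁻¹ * ‖Y₁ - Y‖) ^ 2 ≤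
      ‖L - L'‖ ^ 2 + (m⁻¹ * ‖Y - Y'‖) ^ 2 := by
  -- In terms of the steps `u`, `d` and the new errors `e`, `g`, the old errors are `e - u` and `g -
  -- d`, so the claim reduces to `⟨u, e⟩ + m⁻² ⟨g, d⟩ ≤ 0`.
  obtain ⟨u, hu⟩ : ∃ u, L₁ = L + u := ⟨L₁ - L, by abel⟩
  obtain ⟨d, hd⟩ : ∃ d, Y₁ = Y + d := ⟨Y₁ - Y, by abel⟩
  obtain ⟨e, he⟩ : ∃ e, L' = L + u - e := ⟨L + u - L', by abel⟩
  obtain ⟨g, hg⟩ : ∃ g, Y' = Y + d - g := ⟨Y + d - Y', by abel⟩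
  have hX : X₁ = L + u + m⁻¹ • d := by
    have : m • (X₁ - L₁) = d := by
      rw [hd] at hY
      exact (add_left_cancel hY).symm
    rw [← this, inv_smul_smul₀ hm.ne', hu]
    abel
  subst hu hd he hg hX
  -- Monotonicity of the normal cone of the semidefinite cone: `i1` compares the new iterate with
  -- the optimum, `i2` consecutive iterates. `i3` adds the two `(X, S)` conditions, in which the
  -- `ℓ₁` terms cancel.
  have i1 : 0 ≤ ip g e := by
    simp only [ip_add_left, ip_add_right, ip_sub_left, ip_sub_right] at hL₁ hL' ⊢
    linarith
  have i2 : 0 ≤ ip d u := by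
    simp only [ip_add_left, ip_add_right, ip_sub_left, ip_sub_right] at hL₁' hL ⊢
    linarith
  have i3 : 0 ≤ -(ip g e + m⁻¹ * ip g d + m * ip u e + ip d u) := by
    have e1 : L + u - e - (L + u + m⁻¹ • d) = -(1 : ℝ) • (e + m⁻¹ • d) := by module
    have e2 : L + u + m⁻¹ • d - (L + u - e) = e + m⁻¹ • d := by abel
    have e3 : Y + d + m • (L + u - L) = (Y + d) + m • u := by rw [add_sub_cancel_left]
    rw [e1, e3] at hXS
    rw [e2] at hXS'
    simp only [ip_add_left, ip_add_right, ip_sub_left, ip_smul_left,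
      ip_smul_right, ip_comm u d] at hXS hXS' ⊢
    have : m * (m⁻¹ * ip d u) = ip d u := mul_inv_cancel_left₀ hm.ne' _
    linarith
  have e1 : L + u - (L + u - e) = e := by abel
  have e2 : Y + d - (Y + d - g) = g := by abel
  have e3 : L - (L + u - e) = e + (-1 : ℝ) • u := by module
  have e4 : Y - (Y + d - g) = g + (-1 : ℝ) • d := by module
  rw [e1, e2, e3, e4, add_sub_cancel_left, add_sub_cancel_left, mul_pow, mul_pow, mul_pow,
    norm_add_smul_sq, norm_add_smul_sq, ip_comm e u]
  have i4 : 0 ≤ m⁻¹ * -(m⁻¹ * ip g d + m * ip u e) :=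
    mul_nonneg (inv_nonneg.2 hm.le) (by linarith)
  have : m⁻¹ * (m * ip u e) = ip u e := inv_mul_cancel_left₀ hm.ne' _
  nlinarith

end Optimality

/-! ### Iterates of the algorithm: Lyapunov decrease and vanishing residuals -/

section Run

variable {n : ℕ} {Ω : Set (Fin n × Fin n)} {D : Mat n} {ρ : ℝ} {μ : ℕ → ℝ} {Z : ℕ → Quad n}

theorem IsRun.posSemidef_L (h : IsRun Ω D ρ μ Z) (k : ℕ) : (Z (k + 1)).L.PosSemidef :=
  (h.step_L k).1

theorem IsRun.mem_phi (h : IsRun Ω D ρ μ Z) (k : ℕ) :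
    ((Z (k + 1)).X, (Z (k + 1)).S) ∈ phi Ω D :=
  (h.step_XS k).1

theorem IsRun.isSymm_Y (h : IsRun Ω D ρ μ Z) (hΩ : ∀ i j, (i, j) ∈ Ω → (j, i) ∈ Ω)
    (hD : D.IsSymm) (k : ℕ) : (Z k).Y.IsSymm := by
  classical
  induction k with
  | zero =>
    rw [h.init_Y]
    refine Matrix.IsSymm.smul (Matrix.IsSymm.ext fun i j => ?_) _
    exact if_congr ⟨hΩ j i, hΩ i j⟩ (hD.apply i j) rfl
  | succ k ih =>
    rw [h.step_Y k]
    exact ih.add (((mem_phi_iff.1 (h.mem_phi k)).1.sub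
      (posSemidef_iff_isSymm.1 (h.posSemidef_L k)).1).smul _)

theorem IsRun.variational_L (h : IsRun Ω D ρ μ Z) (hμ : ∀ k, 0 < μ k) (k : ℕ) {L : Mat n}
    (hL : L.PosSemidef) : 0 ≤ ip (1 - (Z (k + 1)).Y) (L - (Z (k + 1)).L) := by
  rw [h.step_Y k]
  exact argmin_L_variational (hμ k) (h.step_L k) hL

/-- The `(X, S)` step sees the old `L_k`, so its multiplier differs from `Y_{k+1}` by `μ_k (L_{k+1}
- L_k)`, an error that vanishes in the limit. -/
theorem IsRun.variational_XS (h : IsRun Ω D ρ μ Z) (hμ : ∀ k, 0 < μ k) (hρ : 0 < ρ) (k : ℕ)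
    {X S : Mat n} (hXS : (X, S) ∈ phi Ω D) :
    0 ≤ ρ * (l1Norm S - l1Norm (Z (k + 1)).S) +
      ip ((Z (k + 1)).Y + μ k • ((Z (k + 1)).L - (Z k).L)) (X - (Z (k + 1)).X) := by
  have := argmin_XS_variational (hμ k) hρ (h.step_XS k) hXS
  convert this using 3
  rw [h.step_Y k]
  module

/-- The Lyapunov function: the squared distance of `(L, m⁻¹ Y)` from an optimal pair. -/
noncomputable def lyapunov (m : ℝ) (W Z : Quad n) : ℝ :=
  ‖Z.L - W.L‖ ^ 2 + (m⁻¹ * ‖Z.Y - W.Y‖) ^ 2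

theorem lyapunov_nonneg (m : ℝ) (W Z : Quad n) : 0 ≤ lyapunov m W Z := by
  unfold lyapunov
  positivity

theorem IsRun.lyapunov_succ_le (h : IsRun Ω D ρ μ Z) (hμ : ∀ k, 0 < μ k)
    (hmono : ∀ k, μ k ≤ μ (k + 1)) (hρ : 0 < ρ) (hΩ : ∀ i j, (i, j) ∈ Ω → (j, i) ∈ Ω)
    {W : Quad n} (hW : W ∈ optPairs Ω D ρ) (k : ℕ) :
    lyapunov (μ (k + 2)) W (Z (k + 2)) + ‖(Z (k + 2)).L - (Z (k + 1)).L‖ ^ 2 +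
      ‖(Z (k + 2)).X - (Z (k + 2)).L‖ ^ 2 ≤ lyapunov (μ (k + 1)) W (Z (k + 1)) := by
  obtain ⟨w1, w2, w3, w4, w5, w6⟩ := (mem_optPairs_iff hΩ hρ).1 hW
  -- The descent estimate needs the `L` condition at the old iterate too, and that is produced by a
  -- previous step; hence the indices start at `1`.
  have d := lyapunov_descent (hμ (k + 1)) (h.step_Y (k + 1))
    (by simpa [w5] using h.variational_XS hμ hρ (k + 1) w2)
    (by simpa [w5] using w6 _ _ (h.mem_phi (k + 1)))
    (h.variational_L hμ (k + 1) w1) (w4 _ (h.posSemidef_L (k + 1)))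
    (h.variational_L hμ (k + 1) (h.posSemidef_L k))
    (h.variational_L hμ k (h.posSemidef_L (k + 1)))
  have e : (μ (k + 1))⁻¹ * ‖(Z (k + 2)).Y - (Z (k + 1)).Y‖ =
      ‖(Z (k + 2)).X - (Z (k + 2)).L‖ := by
    rw [h.step_Y (k + 1), add_sub_cancel_left, norm_smul, Real.norm_of_nonneg (hμ _).le,
      inv_mul_cancel_left₀ (hμ _).ne']
  have hle : ((μ (k + 2))⁻¹ * ‖(Z (k + 2)).Y - W.Y‖) ^ 2 ≤
      ((μ (k + 1))⁻¹ * ‖(Z (k + 2)).Y - W.Y‖) ^ 2 := by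
    have := hμ (k + 1)
    have := hμ (k + 2)
    have := hmono (k + 1)
    gcongr
  unfold lyapunov
  rw [← e]
  linarith

theorem IsRun.antitone_lyapunov (h : IsRun Ω D ρ μ Z) (hμ : ∀ k, 0 < μ k)
    (hmono : ∀ k, μ k ≤ μ (k + 1)) (hρ : 0 < ρ) (hΩ : ∀ i j, (i, j) ∈ Ω → (j, i) ∈ Ω)
    {W : Quad n} (hW : W ∈ optPairs Ω D ρ) :
    Antitone fun k => lyapunov (μ (k + 1)) W (Z (k + 1)) := by
  refine antitone_nat_of_succ_le fun k => ?_
  have := h.lyapunov_succ_le hμ hmono hρ hΩ hW k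
  have h1 := sq_nonneg ‖(Z (k + 2)).L - (Z (k + 1)).L‖
  have h2 := sq_nonneg ‖(Z (k + 2)).X - (Z (k + 2)).L‖
  change lyapunov (μ (k + 2)) W (Z (k + 2)) ≤ _
  linarith

theorem tendsto_zero_iff_norm {E : ℕ → Mat n} :
    Tendsto E atTop (𝓝 0) ↔ Tendsto (fun k => ‖E k‖) atTop (𝓝 0) :=
  tendsto_zero_iff_norm_tendsto_zero

theorem tendsto_zero_of_norm_sq_le {E : ℕ → Mat n} {c : ℕ → ℝ} (h : ∀ k, ‖E k‖ ^ 2 ≤ c k)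
    (hc : Tendsto c atTop (𝓝 0)) : Tendsto E atTop (𝓝 0) := by
  rw [tendsto_zero_iff_norm]
  have := (squeeze_zero (fun k => sq_nonneg _) h hc).sqrt
  simpa [Real.sqrt_sq (norm_nonneg _)] using this

theorem IsRun.tendsto_residuals (h : IsRun Ω D ρ μ Z) (hμ : ∀ k, 0 < μ k)
    (hmono : ∀ k, μ k ≤ μ (k + 1)) (hρ : 0 < ρ) (hΩ : ∀ i j, (i, j) ∈ Ω → (j, i) ∈ Ω)
    {W : Quad n} (hW : W ∈ optPairs Ω D ρ) :
    Tendsto (fun k => (Z (k + 2)).L - (Z (k + 1)).L) atTop (𝓝 0) ∧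
      Tendsto (fun k => (Z (k + 2)).X - (Z (k + 2)).L) atTop (𝓝 0) := by
  have hlim := tendsto_atTop_ciInf (h.antitone_lyapunov hμ hmono hρ hΩ hW)
    ⟨0, by rintro _ ⟨k, rfl⟩; exact lyapunov_nonneg _ _ _⟩
  have hdiff := hlim.sub ((tendsto_add_atTop_iff_nat 1).2 hlim)
  rw [sub_self] at hdiff
  refine ⟨tendsto_zero_of_norm_sq_le (fun k => ?_) hdiff,
    tendsto_zero_of_norm_sq_le (fun k => ?_) hdiff⟩
  all_goals
    have := h.lyapunov_succ_le hμ hmono hρ hΩ hW k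
    have h1 := sq_nonneg ‖(Z (k + 2)).L - (Z (k + 1)).L‖
    have h2 := sq_nonneg ‖(Z (k + 2)).X - (Z (k + 2)).L‖
    change _ ≤ lyapunov (μ (k + 1)) W (Z (k + 1)) - lyapunov (μ (k + 2)) W (Z (k + 2))
    linarith

end Run

/-! ### Compactness, optimality of cluster points and convergence of the distance -/

section Limit

variable {n : ℕ} {Ω : Set (Fin n × Fin n)} {D : Mat n} {ρ : ℝ} {μ : ℕ → ℝ} {Z : ℕ → Quad n}

/-- A quadruple as a point of a product of normed spaces. -/
def Quad.toProd (W : Quad n) : Mat n × Mat n × Mat n × Mat n := (W.L, W.X, W.S, W.Y)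

/-- The inverse of `Quad.toProd`. -/
def Quad.ofProd (p : Mat n × Mat n × Mat n × Mat n) : Quad n := ⟨p.1, p.2.1, p.2.2.1, p.2.2.2⟩

theorem Quad.ofProd_toProd (W : Quad n) : Quad.ofProd W.toProd = W := rfl

theorem continuous_dist_ofProd (Q : Quad n) :
    Continuous fun p : Mat n × Mat n × Mat n × Mat n => Q.dist (Quad.ofProd p) := by
  unfold Quad.dist Quad.frob Quad.ofProd
  fun_prop

theorem continuous_ofProd_dist (Q : Quad n) :
    Continuous fun p : Mat n × Mat n × Mat n × Mat n => (Quad.ofProd p).dist Q := by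
  unfold Quad.dist Quad.frob Quad.ofProd
  fun_prop

theorem tendsto_ip {A B : ℕ → Mat n} {A' B' : Mat n} (hA : Tendsto A atTop (𝓝 A'))
    (hB : Tendsto B atTop (𝓝 B')) :
    Tendsto (fun k => ip (A k) (B k)) atTop (𝓝 (ip A' B')) := by
  simp only [ip_eq_sum]
  refine tendsto_finsetSum _ fun i _ => tendsto_finsetSum _ fun j _ => ?_
  have hc : Continuous fun M : Mat n => M i j := by fun_prop
  exact ((hc.tendsto A').comp hA).mul ((hc.tendsto B').comp hB)

theorem Quad.norm_le_frob (W : Quad n) :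
    ‖W.L‖ ≤ W.frob ∧ ‖W.X‖ ≤ W.frob ∧ ‖W.S‖ ≤ W.frob ∧ ‖W.Y‖ ≤ W.frob := by
  refine ⟨Real.le_sqrt_of_sq_le ?_, Real.le_sqrt_of_sq_le ?_, Real.le_sqrt_of_sq_le ?_,
    Real.le_sqrt_of_sq_le ?_⟩
  all_goals linarith [sq_nonneg ‖W.L‖, sq_nonneg ‖W.X‖, sq_nonneg ‖W.S‖, sq_nonneg ‖W.Y‖]

theorem Quad.frob_le_sum (W : Quad n) : W.frob ≤ ‖W.L‖ + ‖W.X‖ + ‖W.S‖ + ‖W.Y‖ := by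
  refine Real.sqrt_le_iff.2 ⟨by positivity, ?_⟩
  have := norm_nonneg W.L
  have := norm_nonneg W.X
  have := norm_nonneg W.S
  have := norm_nonneg W.Y
  nlinarith [mul_nonneg (norm_nonneg W.L) (norm_nonneg W.X),
    mul_nonneg (norm_nonneg W.L) (norm_nonneg W.S), mul_nonneg (norm_nonneg W.L) (norm_nonneg W.Y),
    mul_nonneg (norm_nonneg W.X) (norm_nonneg W.S), mul_nonneg (norm_nonneg W.X) (norm_nonneg W.Y),
    mul_nonneg (norm_nonneg W.S) (norm_nonneg W.Y)]

theorem isCompact_norm_le (C : ℝ) : IsCompact {A : Mat n | ‖A‖ ≤ C} := by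
  have : {A : Mat n | ‖A‖ ≤ C} = Metric.closedBall (0 : Mat n) C := by
    ext A
    simp
  rw [this]
  have : ProperSpace (Mat n) := FiniteDimensional.proper ℝ _
  exact isCompact_closedBall _ _

theorem isCompact_frob_le (C : ℝ) :
    IsCompact {p : Mat n × Mat n × Mat n × Mat n | (Quad.ofProd p).frob ≤ C} := by
  have hB := isCompact_norm_le (n := n) C
  refine (hB.prod (hB.prod (hB.prod hB))).of_isClosed_subset ?_ fun p hp => ?_
  · refine isClosed_le ?_ continuous_const
    unfold Quad.frob Quad.ofProd
    fun_prop
  · obtain ⟨h1, h2, h3, h4⟩ := (Quad.ofProd p).norm_le_frob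
    exact ⟨h1.trans hp, h2.trans hp, h3.trans hp, h4.trans hp⟩

theorem Quad.frob_le_of_dist (Q W : Quad n) :
    W.frob ≤ ‖Q.L‖ + ‖Q.X‖ + ‖Q.S‖ + ‖Q.Y‖ + 4 * Q.dist W := by
  obtain ⟨h1, h2, h3, h4⟩ :=
    (⟨Q.L - W.L, Q.X - W.X, Q.S - W.S, Q.Y - W.Y⟩ : Quad n).norm_le_frob
  have hd : Quad.frob ⟨Q.L - W.L, Q.X - W.X, Q.S - W.S, Q.Y - W.Y⟩ = Q.dist W := rfl
  rw [hd] at h1 h2 h3 h4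
  rw [norm_sub_rev] at h1 h2 h3 h4
  have := W.frob_le_sum
  linarith [norm_sub_norm_le W.L Q.L, norm_sub_norm_le W.X Q.X, norm_sub_norm_le W.S Q.S,
    norm_sub_norm_le W.Y Q.Y]

theorem isClosed_optPairs (hΩ : ∀ i j, (i, j) ∈ Ω → (j, i) ∈ Ω) (hρ : 0 < ρ) :
    IsClosed {p : Mat n × Mat n × Mat n × Mat n | Quad.ofProd p ∈ optPairs Ω D ρ} := by
  have : {p : Mat n × Mat n × Mat n × Mat n | Quad.ofProd p ∈ optPairs Ω D ρ} =
      {p | p.1 ∈ {A : Mat n | A.PosSemidef}} ∩ {p | (p.2.1, p.2.2.1) ∈ phi Ω D} ∩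
      {p | p.2.2.2.transpose = p.2.2.2} ∩
      (⋂ L : Mat n, ⋂ _ : L.PosSemidef, {p | 0 ≤ ip (1 - p.2.2.2) (L - p.1)}) ∩
      {p | p.2.1 = p.1} ∩
      (⋂ X : Mat n, ⋂ S : Mat n, ⋂ _ : (X, S) ∈ phi Ω D,
        {p | 0 ≤ ρ * (l1Norm S - l1Norm p.2.2.1) + ip p.2.2.2 (X - p.2.1)}) := by
    ext p
    rw [Set.mem_ofPred_eq, mem_optPairs_iff hΩ hρ]
    simp only [Set.mem_inter_iff, Set.mem_iInter, Set.mem_ofPred_eq, Matrix.IsSymm,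
      Quad.ofProd]
    tauto
  rw [this]
  refine (((((isClosed_posSemidef.preimage continuous_fst).inter
    (isClosed_phi.preimage (f := fun p : Mat n × Mat n × Mat n × Mat n => (p.2.1, p.2.2.1))
      (by fun_prop))).inter ?_).inter ?_).inter ?_).inter ?_
  · exact isClosed_eq (by fun_prop) (by fun_prop)
  · exact isClosed_iInter fun L => isClosed_iInter fun _ =>
      isClosed_le (by fun_prop) (by fun_prop)
  · exact isClosed_eq (by fun_prop) (by fun_prop)
  · exact isClosed_iInter fun X => isClosed_iInter fun S => isClosed_iInter fun _ =>
      isClosed_le (by fun_prop) (by fun_prop)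

theorem exists_isLeast_dist (hΩ : ∀ i j, (i, j) ∈ Ω → (j, i) ∈ Ω) (hρ : 0 < ρ)
    (hne : (optPairs Ω D ρ).Nonempty) (Q : Quad n) :
    ∃ d, IsLeast ((fun W => Q.dist W) '' optPairs Ω D ρ) d := by
  obtain ⟨W₀, hW₀⟩ := hne
  let f : Mat n × Mat n × Mat n × Mat n → ℝ := fun p => Q.dist (Quad.ofProd p)
  have hf : Continuous f := continuous_dist_ofProd Q
  -- The optimal set is closed but need not be bounded; only points no farther than `W₀` compete.
  let K := {p : Mat n × Mat n × Mat n × Mat n | Quad.ofProd p ∈ optPairs Ω D ρ} ∩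
    {p | f p ≤ Q.dist W₀}
  have hK : IsCompact K := by
    refine (isCompact_frob_le (‖Q.L‖ + ‖Q.X‖ + ‖Q.S‖ + ‖Q.Y‖ + 4 * Q.dist W₀)).of_isClosed_subset
      ((isClosed_optPairs hΩ hρ).inter (isClosed_le hf continuous_const)) fun p hp => ?_
    have h1 := Q.frob_le_of_dist (Quad.ofProd p)
    have h2 : Q.dist (Quad.ofProd p) ≤ Q.dist W₀ := hp.2
    exact h1.trans (by linarith)
  have hf₀ : ∀ W : Quad n, f W.toProd = Q.dist W := fun W => rfl
  have hmem : ∀ W ∈ optPairs Ω D ρ, Q.dist W ≤ Q.dist W₀ → W.toProd ∈ K := fun W hW hd =>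
    ⟨by rwa [Set.mem_ofPred_eq, Quad.ofProd_toProd], by rwa [Set.mem_ofPred_eq, hf₀]⟩
  obtain ⟨p, hp, hmin⟩ := hK.exists_isMinOn ⟨W₀.toProd, hmem W₀ hW₀ le_rfl⟩ hf.continuousOn
  refine ⟨f p, Set.mem_image_of_mem _ hp.1, ?_⟩
  rintro _ ⟨W, hW, rfl⟩
  change f p ≤ Q.dist W
  by_cases hd : Q.dist W ≤ Q.dist W₀
  · rw [← hf₀ W]
    exact isMinOn_iff.1 hmin W.toProd (hmem W hW hd)
  · exact hp.2.trans (not_le.1 hd).le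

theorem IsRun.exists_frob_le (h : IsRun Ω D ρ μ Z) (hμ : ∀ k, 0 < μ k)
    (hmono : ∀ k, μ k ≤ μ (k + 1)) {B : ℝ} (hB : ∀ k, μ k ≤ B) (hρ : 0 < ρ)
    (hΩ : ∀ i j, (i, j) ∈ Ω → (j, i) ∈ Ω) (hne : (optPairs Ω D ρ).Nonempty) :
    ∃ C : ℝ, ∀ k, (Z k).frob ≤ C := by
  obtain ⟨W, hW⟩ := hne
  set c := Real.sqrt (lyapunov (μ 1) W (Z 1))
  have hB0 : 0 < B := (hμ 0).trans_le (hB 0)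
  have hlyap : ∀ k, lyapunov (μ (k + 1)) W (Z (k + 1)) ≤ lyapunov (μ 1) W (Z 1) := fun k =>
    h.antitone_lyapunov hμ hmono hρ hΩ hW (Nat.zero_le k)
  have hL : ∀ k, ‖(Z (k + 1)).L‖ ≤ c + ‖W.L‖ := by
    intro k
    have h1 : ‖(Z (k + 1)).L - W.L‖ ≤ c := by
      refine Real.le_sqrt_of_sq_le (le_trans ?_ (hlyap k))
      exact le_add_of_nonneg_right (sq_nonneg _)
    linarith [norm_sub_norm_le (Z (k + 1)).L W.L]
  have hY : ∀ k, ‖(Z (k + 1)).Y‖ ≤ B * c + ‖W.Y‖ := by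
    intro k
    have h1 : (μ (k + 1))⁻¹ * ‖(Z (k + 1)).Y - W.Y‖ ≤ c := by
      refine Real.le_sqrt_of_sq_le (le_trans ?_ (hlyap k))
      exact le_add_of_nonneg_left (sq_nonneg _)
    have h2 : ‖(Z (k + 1)).Y - W.Y‖ ≤ B * c := by
      rw [inv_mul_le_iff₀ (hμ _)] at h1
      exact h1.trans (mul_le_mul_of_nonneg_right (hB _) (Real.sqrt_nonneg _))
    linarith [norm_sub_norm_le (Z (k + 1)).Y W.Y]
  have hS : ∀ k, ‖(Z (k + 1)).S‖ ≤ n := fun k =>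
    norm_le_of_abs_le_one (abs_le_one_of_mem_phi (h.mem_phi k))
  have hX : ∀ k, ‖(Z (k + 2)).X‖ ≤ c + (c + ‖W.L‖) := by
    intro k
    have h1 : ‖(Z (k + 2)).X - (Z (k + 2)).L‖ ≤ c := by
      refine Real.le_sqrt_of_sq_le (le_trans ?_ (hlyap k))
      have h0 := lyapunov_nonneg (μ (k + 2)) W (Z (k + 2))
      have h1 := h.lyapunov_succ_le hμ hmono hρ hΩ hW k
      have h2 := sq_nonneg ‖(Z (k + 2)).L - (Z (k + 1)).L‖
      linarith
    linarith [norm_sub_norm_le (Z (k + 2)).X (Z (k + 2)).L, hL (k + 1)]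
  -- The bound on `X` comes from a Lyapunov decrease, available from index `2`; the first two
  -- iterates are added by hand.
  refine ⟨max (Z 0).frob (max (Z 1).frob
    ((c + ‖W.L‖) + (c + (c + ‖W.L‖)) + n + (B * c + ‖W.Y‖))), fun k => ?_⟩
  match k with
  | 0 => exact le_max_left _ _
  | 1 => exact le_max_of_le_right (le_max_left _ _)
  | k + 2 =>
    refine le_max_of_le_right (le_max_of_le_right ((Quad.frob_le_sum _).trans ?_))
    linarith [hL (k + 1), hY (k + 1), hS (k + 1), hX k]

theorem IsRun.mem_optPairs_of_tendsto (h : IsRun Ω D ρ μ Z) (hμ : ∀ k, 0 < μ k)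
    (hmono : ∀ k, μ k ≤ μ (k + 1)) {B : ℝ} (hB : ∀ k, μ k ≤ B) (hρ : 0 < ρ)
    (hΩ : ∀ i j, (i, j) ∈ Ω → (j, i) ∈ Ω) (hD : D.IsSymm) (hne : (optPairs Ω D ρ).Nonempty)
    {ns : ℕ → ℕ} (hns : Tendsto ns atTop atTop) {p : Mat n × Mat n × Mat n × Mat n}
    (hp : Tendsto (fun k => (Z (ns k + 2)).toProd) atTop (𝓝 p)) :
    Quad.ofProd p ∈ optPairs Ω D ρ := by
  obtain ⟨W, hW⟩ := hne
  obtain ⟨hr1, hr2⟩ := h.tendsto_residuals hμ hmono hρ hΩ hW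
  have pL : Tendsto (fun k => (Z (ns k + 2)).L) atTop (𝓝 p.1) := hp.fst_nhds
  have pX : Tendsto (fun k => (Z (ns k + 2)).X) atTop (𝓝 p.2.1) := hp.snd_nhds.fst_nhds
  have pS : Tendsto (fun k => (Z (ns k + 2)).S) atTop (𝓝 p.2.2.1) :=
    hp.snd_nhds.snd_nhds.fst_nhds
  have pY : Tendsto (fun k => (Z (ns k + 2)).Y) atTop (𝓝 p.2.2.2) :=
    hp.snd_nhds.snd_nhds.snd_nhds
  have hE : Tendsto (fun k => μ (k + 1) • ((Z (k + 2)).L - (Z (k + 1)).L)) atTop (𝓝 0) := by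
    rw [tendsto_zero_iff_norm] at hr1 ⊢
    refine squeeze_zero (fun k => norm_nonneg _) (fun k => ?_)
      (by simpa using hr1.const_mul B)
    rw [norm_smul, Real.norm_of_nonneg (hμ _).le]
    exact mul_le_mul_of_nonneg_right (hB _) (norm_nonneg _)
  refine (mem_optPairs_iff hΩ hρ).2 ⟨?_, ?_, ?_, fun L hL => ?_, ?_, fun X S hXS => ?_⟩
  · exact isClosed_posSemidef.mem_of_tendsto pL
      (Eventually.of_forall fun k => h.posSemidef_L (ns k + 1))
  · exact isClosed_phi.mem_of_tendsto (pX.prodMk_nhds pS)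
      (Eventually.of_forall fun k => h.mem_phi (ns k + 1))
  · have hc : IsClosed {A : Mat n | A.transpose = A} :=
      isClosed_eq (by fun_prop) (by fun_prop)
    exact hc.mem_of_tendsto pY
      (Eventually.of_forall fun k => h.isSymm_Y hΩ hD (ns k + 2))
  · exact ge_of_tendsto' (tendsto_ip (tendsto_const_nhds.sub pY) (tendsto_const_nhds.sub pL))
      fun k => h.variational_L hμ (ns k + 1) hL
  · have := tendsto_nhds_unique (pX.sub pL) (hr2.comp hns)
    exact sub_eq_zero.1 this
  · have hl : Tendsto (fun k => l1Norm (Z (ns k + 2)).S) atTop (𝓝 (l1Norm p.2.2.1)) :=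
      (continuous_l1Norm.tendsto _).comp pS
    have ht := ((tendsto_const_nhds (x := l1Norm S)).sub hl |>.const_mul ρ).add
      (tendsto_ip (pY.add (hE.comp hns)) ((tendsto_const_nhds (x := X)).sub pX))
    have hlim := ge_of_tendsto' ht fun k => h.variational_XS hμ hρ (ns k + 1) hXS
    rwa [add_zero] at hlim

theorem IsRun.tendsto_dist_zero (h : IsRun Ω D ρ μ Z) (hμ : ∀ k, 0 < μ k)
    (hmono : ∀ k, μ k ≤ μ (k + 1)) {B : ℝ} (hB : ∀ k, μ k ≤ B) (hρ : 0 < ρ)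
    (hΩ : ∀ i j, (i, j) ∈ Ω → (j, i) ∈ Ω) (hD : D.IsSymm) (hne : (optPairs Ω D ρ).Nonempty)
    {d : ℕ → ℝ}
    (hd : ∀ k, IsLeast ((fun W => (Z k).dist W) '' optPairs Ω D ρ) (d k)) :
    Tendsto d atTop (𝓝 0) := by
  rw [← tendsto_add_atTop_iff_nat 2]
  obtain ⟨C, hC⟩ := h.exists_frob_le hμ hmono hB hρ hΩ hne
  -- Each subsequence has a further one converging to an optimal `p`, and the minimal distance is at
  -- most the distance to `p`.
  refine tendsto_of_subseq_tendsto fun ns hns => ?_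
  have : FirstCountableTopology (Mat n) :=
    inferInstanceAs (FirstCountableTopology (Fin n → Fin n → ℝ))
  obtain ⟨p, -, φ, hφ, hp⟩ := (isCompact_frob_le (n := n) C).tendsto_subseq
    (x := fun k => (Z (ns k + 2)).toProd) fun k => hC _
  have hmem := h.mem_optPairs_of_tendsto hμ hmono hB hρ hΩ hD hne
    (hns.comp hφ.tendsto_atTop) hp
  refine ⟨φ, squeeze_zero (fun k => ?_) (fun k => (hd _).2 ⟨_, hmem, rfl⟩) ?_⟩
  · obtain ⟨W, -, hW⟩ := (hd (ns (φ k) + 2)).1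
    rw [← hW]
    exact Real.sqrt_nonneg _
  · have ht := ((continuous_ofProd_dist (Quad.ofProd p)).tendsto p).comp hp
    have h0 : (Quad.ofProd p).dist (Quad.ofProd p) = 0 := by
      simp [Quad.dist, Quad.frob]
    simp only [h0] at ht
    exact ht

end Limit

/-! ### The node-node matrix as data of the problem -/

section Network

variable {n : ℕ}

theorem netMatrix_isSymm (G : SimpleGraph (Fin n)) : (netMatrix G).IsSymm := by
  classical
  refine Matrix.IsSymm.ext fun i j => ?_
  exact if_congr (or_congr eq_comm (G.adj_comm j i)) rfl rfl

theorem netMatrix_diag (G : SimpleGraph (Fin n)) (i : Fin n) : netMatrix G i i = 1 := by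
  simp [netMatrix]

theorem abs_netMatrix_le (G : SimpleGraph (Fin n)) (i j : Fin n) : |netMatrix G i j| ≤ 1 := by
  unfold netMatrix
  split_ifs <;> simp

end Network

end ADMIPC

theorem theorem3 {n : ℕ} (G : SimpleGraph (Fin n)) (Ω : Set (Fin n × Fin n))
    (hΩdiag : ∀ i, (i, i) ∈ Ω) (hΩsymm : ∀ i j, (i, j) ∈ Ω → (j, i) ∈ Ω)
    (ρ : ℝ) (hρ : 0 < ρ)
    (μ : ℕ → ℝ) (hμpos : ∀ k, 0 < μ k) (hμmono : ∀ k, μ k ≤ μ (k + 1))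
    (hμbdd : BddAbove (Set.range μ))
    (Z : ℕ → ADMIPC.Quad n) (hZ : ADMIPC.IsRun Ω (ADMIPC.netMatrix G) ρ μ Z) :
    (∃ d : ℕ → ℝ,
      (∀ k, IsLeast
        ((fun W => (Z k).dist W) '' ADMIPC.optPairs Ω (ADMIPC.netMatrix G) ρ) (d k)) ∧
      Tendsto d atTop (𝓝 0)) ∧
    ∃ C : ℝ, ∀ k, (Z k).frob ≤ C := by
  obtain ⟨B, hB⟩ := hμbdd
  have hB' : ∀ k, μ k ≤ B := fun k => hB ⟨k, rfl⟩
  have hne := ADMIPC.optPairs_nonempty hΩdiag hΩsymm hρ (ADMIPC.netMatrix_isSymm G)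
    (ADMIPC.netMatrix_diag G) (ADMIPC.abs_netMatrix_le G)
  choose d hd using fun k => ADMIPC.exists_isLeast_dist hΩsymm hρ hne (Z k)
  exact ⟨⟨d, hd, hZ.tendsto_dist_zero hμpos hμmono hB' hρ hΩsymm
    (ADMIPC.netMatrix_isSymm G) hne hd⟩, hZ.exists_frob_le hμpos hμmono hB' hρ hΩsymm hne⟩
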